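/- Let $\tau(n)$ be Ramanujan's function, defined by $\sum_{n\ge1}\tau(n)q^n = q\prod_{m\ge1}(1-q^m)^{24}$, and let $F$ be the entire function obtained by analytic continuation of the Dirichlet series $F(s)=\sum_{n=1}^{\infty}\tau(n)n^{-s}$, which converges absolutely for $\operatorname{Re}s$ sufficiently large (for instance $\operatorname{Re} s>7$). Then for every complex number $s=\sigma+it$ with $6<\sigma<\tfrac{13}{2}$, $t\ge 3.8085$ and $F(s)\ne 0$, $$|F(12-s)|>|F(s)|.$$ -/

import Mathlib

open scoped MatrixGroups

/-- Ramanujan's `τ`: the coefficient of `q ^ n` in the `q`-expansion, `q = exp (2 π i z)`, of the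
modular discriminant `Δ(z) = η(z) ^ 24 = q ∏ (1 - q ^ m) ^ 24`, as a complex number. -/
noncomputable def ramanujanTau (n : ℕ) : ℂ :=
  (UpperHalfPlane.qExpansion 1 ModularForm.discriminant).coeff n

/-- The function `F(s) = ∑ τ(n) n ^ (-s)`, continued to the whole complex plane: the `L`-function
(without Gamma factor) of the weight 12 cusp form `Δ`. The lemmas below show that it is entire, that
it is the sum of the Dirichlet series for `7 < re s`, and that it is the only such function. -/
noncomputable def ramanujanL (s : ℂ) : ℂ :=
  ModularForm.L (Γ := 𝒮ℒ) (k := 12) (by norm_num) CuspForm.discriminant s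

lemma differentiable_ramanujanL : Differentiable ℂ ramanujanL :=
  CuspForm.differentiable_L (Γ := 𝒮ℒ) (k := 12) (by norm_num) CuspForm.discriminant

lemma hasSum_ramanujanTau (z : UpperHalfPlane) :
    HasSum (fun n : ℕ ↦ ramanujanTau n * Complex.exp (2 * Real.pi * Complex.I * z) ^ n)
      (ModularForm.discriminant z) := by
  have h := ModularForm.hasSum_qExpansion (Γ := 𝒮ℒ) (k := 12) CuspForm.discriminant
    one_pos one_mem_strictPeriods_SL z
  simpa [ramanujanTau, Function.Periodic.qParam] using h

lemma ramanujanTau_one : ramanujanTau 1 = 1 :=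
  ModularForm.discriminant_qExpansion_coeff_one

lemma hasSum_ramanujanL {s : ℂ} (hs : 7 < s.re) :
    HasSum (fun n : ℕ ↦ ramanujanTau n / (n : ℂ) ^ s) (ramanujanL s) := by
  have hk : (0 : ℤ) < 12 := by norm_num
  have hs' : ((12 : ℤ) : ℝ) / 2 + 1 < s.re := by norm_num; exact hs
  have h := CuspForm.hasSum_L (Γ := 𝒮ℒ) (k := 12) hk CuspForm.discriminant hs'
  rw [Subgroup.strictWidthInfty_SL2Z, Complex.ofReal_one, Complex.one_cpow, one_mul] at h
  exact h

lemma ramanujanL_unique {G : ℂ → ℂ} (hG : Differentiable ℂ G)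
    (h : ∀ s : ℂ, 7 < s.re → HasSum (fun n : ℕ ↦ ramanujanTau n / (n : ℂ) ^ s) (G s)) :
    G = ramanujanL := by
  refine AnalyticOnNhd.eq_of_eventuallyEq (z₀ := 8) (fun z _ ↦ hG.analyticAt z)
    (fun z _ ↦ differentiable_ramanujanL.analyticAt z) ?_
  filter_upwards [(isOpen_lt continuous_const Complex.continuous_re).mem_nhds
    (show (7 : ℝ) < (8 : ℂ).re by norm_num)] with s hs
  exact (h s hs).unique (hasSum_ramanujanL hs)

open Filter Topology

/-! The functional equation turns the claim into `‖Gammaℂ (12 - s)‖ < ‖Gammaℂ s‖`, that is, `|Γ(s) /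
Γ(12 - s)| > (4π²) ^ x` with `x = σ - 6`. By Euler's limit formula the Gamma quotient is the limit
of `n ^ (2x) ∏ |12 - s + j| / |s + j|`. With `u = 6 + j`, each squared factor is `((u - x)² + t²) /
((u + x)² + t²)`. It increases with `t²`, so `t²` may be lowered to `19/2`; its logarithm is then
concave in `x` and vanishes at `0`, so it lies above its chord on `[0, 1/2]`. The chord bounds
telescope over `j`, leaving `(159/4) ^ x` in the limit, where `159/4 = (11/2)² + 19/2 > 4π²`. -/

/-- The logarithm of the ratio `((u - x)² + 19/2) / ((u + x)² + 19/2)` is concave in `x` on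
`[0, 1/2]`. -/
lemma concaveOn_log_sq_add_sub {u : ℝ} (hu : 6 ≤ u) :
    ConcaveOn ℝ (Set.Icc 0 (1 / 2))
      (fun x : ℝ ↦ Real.log ((u - x) ^ 2 + 19 / 2) - Real.log ((u + x) ^ 2 + 19 / 2)) := by
  have hd (x : ℝ) : HasDerivAt
      (fun x : ℝ ↦ Real.log ((u - x) ^ 2 + 19 / 2) - Real.log ((u + x) ^ 2 + 19 / 2))
      (-(4 * u * ((u ^ 2 - x ^ 2 + 19 / 2) /
        (((u - x) ^ 2 + 19 / 2) * ((u + x) ^ 2 + 19 / 2))))) x := by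
    have h1 : HasDerivAt (fun x : ℝ ↦ (u - x) ^ 2 + 19 / 2) (-(2 * (u - x))) x := by
      convert! (((hasDerivAt_id x).const_sub u).pow 2).add_const (19 / 2 : ℝ) using 1
      simp
    have h2 : HasDerivAt (fun x : ℝ ↦ (u + x) ^ 2 + 19 / 2) (2 * (u + x)) x := by
      convert! (((hasDerivAt_id x).const_add u).pow 2).add_const (19 / 2 : ℝ) using 1
      simp
    have p1 : (u - x) ^ 2 + 19 / 2 ≠ 0 := by positivity
    have p2 : (u + x) ^ 2 + 19 / 2 ≠ 0 := by positivity
    convert! (h1.log p1).sub (h2.log p2) using 1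
    field_simp
    ring
  refine AntitoneOn.concaveOn_of_deriv (convex_Icc _ _)
    (fun x _ ↦ (hd x).continuousAt.continuousWithinAt)
    (fun x _ ↦ (hd x).differentiableAt.differentiableWithinAt) ?_
  rw [interior_Icc]
  rintro x ⟨hx0, -⟩ y ⟨-, hy1⟩ hxy
  rw [(hd x).deriv, (hd y).deriv, neg_le_neg_iff]
  have hden (z : ℝ) : ((u - z) ^ 2 + 19 / 2) * ((u + z) ^ 2 + 19 / 2)
      = (u ^ 2 - z ^ 2) ^ 2 + 19 * (u ^ 2 + z ^ 2) + 361 / 4 := by ring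
  refine mul_le_mul_of_nonneg_left ?_ (by linarith)
  rw [div_le_div_iff₀ (by positivity) (by positivity), hden, hden]
  have ha0 : 0 ≤ x ^ 2 := sq_nonneg x
  have hab : x ^ 2 ≤ y ^ 2 := pow_le_pow_left₀ hx0.le hxy 2
  have hb : y ^ 2 ≤ 1 / 4 := by nlinarith
  have hU : 36 ≤ u ^ 2 := by nlinarith
  generalize u ^ 2 = U at *
  generalize x ^ 2 = a at *
  generalize y ^ 2 = b at *
  -- The cross-multiplied difference of the two sides, factored. The bracket is nonnegative because
  -- `U ≥ 36` exceeds `3 * 19/2` with room for the terms in `a, b ≤ 1/4`.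
  have key : 0 ≤ (b - a) * ((U - a) * (U - b) + 19 / 2 * (2 * U - a - b)
      - 38 * U - 3 * 361 / 4) := by
    refine mul_nonneg (by linarith) ?_
    nlinarith [mul_nonneg (sub_nonneg.2 hU) (sub_nonneg.2 hU)]
  nlinarith [key]

lemma log_sq_add_sub_lower_bound {u x : ℝ} (hu : 6 ≤ u) (hx0 : 0 ≤ x) (hx : x ≤ 1 / 2) :
    2 * x * (Real.log ((u - 1 / 2) ^ 2 + 19 / 2) - Real.log ((u + 1 / 2) ^ 2 + 19 / 2)) ≤
      Real.log ((u - x) ^ 2 + 19 / 2) - Real.log ((u + x) ^ 2 + 19 / 2) := by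
  have h := (concaveOn_log_sq_add_sub hu).2 (Set.left_mem_Icc.2 (by norm_num))
    (Set.right_mem_Icc.2 (by norm_num)) (by linarith : 0 ≤ 1 - 2 * x)
    (by linarith : 0 ≤ 2 * x) (by ring)
  have e : 2 * x * 2⁻¹ = x := by ring
  simpa [e] using h

/-- Lower bound for a single factor of the Euler product of the ratio of two Gamma values. -/
lemma rpow_sq_add_div_le {u x T : ℝ} (hu : 6 ≤ u) (hx0 : 0 ≤ x) (hx : x ≤ 1 / 2)
    (hT : 19 / 2 ≤ T) :
    (((u - 1 / 2) ^ 2 + 19 / 2) / ((u + 1 / 2) ^ 2 + 19 / 2)) ^ (2 * x) ≤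
      ((u - x) ^ 2 + T) / ((u + x) ^ 2 + T) := by
  calc _ ≤ ((u - x) ^ 2 + 19 / 2) / ((u + x) ^ 2 + 19 / 2) := by
        rw [← Real.log_le_log_iff (by positivity) (by positivity), Real.log_rpow (by positivity),
          Real.log_div (by positivity) (by positivity),
          Real.log_div (by positivity) (by positivity)]
        exact log_sq_add_sub_lower_bound hu hx0 hx
    _ ≤ _ := by
        rw [div_le_div_iff₀ (by positivity) (by nlinarith [sq_nonneg (u + x)])]
        nlinarith [mul_nonneg (mul_nonneg (by linarith : 0 ≤ u) hx0) (sub_nonneg.2 hT)]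

lemma norm_add_natCast_sq (s : ℂ) (j : ℕ) : ‖s + j‖ ^ 2 = (s.re + j) ^ 2 + s.im ^ 2 := by
  rw [Complex.sq_norm, Complex.normSq_apply]
  simp
  ring

lemma rpow_mul_norm_add_natCast_le {s : ℂ} (h0 : 6 ≤ s.re) (h1 : s.re ≤ 13 / 2)
    (ht : 19 / 2 ≤ s.im ^ 2) (j : ℕ) :
    (((11 / 2 + j : ℝ) ^ 2 + 19 / 2) / ((13 / 2 + j : ℝ) ^ 2 + 19 / 2)) ^ (s.re - 6) * ‖s + j‖ ≤
      ‖12 - s + j‖ := by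
  refine (sq_le_sq₀ (by positivity) (norm_nonneg _)).1 ?_
  have hj : (0 : ℝ) ≤ j := j.cast_nonneg
  have h := rpow_sq_add_div_le (u := 6 + j) (x := s.re - 6) (T := s.im ^ 2) (by linarith)
    (by linarith) (by linarith) ht
  rw [le_div_iff₀ (by nlinarith [sq_nonneg (6 + j + (s.re - 6))])] at h
  have e1 : (6 + j - 1 / 2 : ℝ) = 11 / 2 + j := by ring
  have e2 : (6 + j + 1 / 2 : ℝ) = 13 / 2 + j := by ring
  have e3 : 6 + j + (s.re - 6) = s.re + j := by ring
  have e4 : 6 + j - (s.re - 6) = (12 - s).re + j := by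
    simp
    ring
  have e5 : (12 - s).im = -s.im := by simp
  rw [e1, e2, e3, e4] at h
  rwa [mul_pow, norm_add_natCast_sq, norm_add_natCast_sq, ← Real.rpow_mul_natCast (by positivity),
    e5, neg_sq, mul_comm (s.re - 6), Nat.cast_ofNat]

/-- The chord endpoints `u ± 1/2` for consecutive `j` coincide, so the product of the bounds
telescopes. -/
lemma rpow_mul_prod_norm_add_natCast_le {s : ℂ} (h0 : 6 ≤ s.re) (h1 : s.re ≤ 13 / 2)
    (ht : 19 / 2 ≤ s.im ^ 2) (n : ℕ) :
    ((159 / 4 : ℝ) / ((11 / 2 + n : ℝ) ^ 2 + 19 / 2)) ^ (s.re - 6) *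
      ∏ j ∈ Finset.range n, ‖s + j‖ ≤ ∏ j ∈ Finset.range n, ‖12 - s + j‖ := by
  induction n with
  | zero => norm_num
  | succ n ih =>
    rw [Finset.prod_range_succ, Finset.prod_range_succ]
    have e : (159 / 4 : ℝ) / ((11 / 2 + (n + 1 : ℕ) : ℝ) ^ 2 + 19 / 2) =
        (159 / 4 : ℝ) / ((11 / 2 + n : ℝ) ^ 2 + 19 / 2) *
        (((11 / 2 + n : ℝ) ^ 2 + 19 / 2) / ((13 / 2 + n : ℝ) ^ 2 + 19 / 2)) := by
      rw [div_mul_div_cancel₀ (by positivity)]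
      push_cast
      ring
    rw [e, Real.mul_rpow (by positivity) (by positivity), mul_mul_mul_comm]
    exact mul_le_mul ih (rpow_mul_norm_add_natCast_le h0 h1 ht n) (by positivity)
      (Finset.prod_nonneg fun _ _ ↦ norm_nonneg _)

lemma norm_GammaSeq (s : ℂ) {n : ℕ} (hn : n ≠ 0) :
    ‖Complex.GammaSeq s n‖ =
      (n : ℝ) ^ s.re * n.factorial / ∏ j ∈ Finset.range (n + 1), ‖s + j‖ := by
  rw [Complex.GammaSeq, norm_div, norm_mul, norm_prod,
    Complex.norm_natCast_cpow_of_pos (Nat.pos_of_ne_zero hn), Complex.norm_natCast]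

lemma rpow_mul_norm_GammaSeq_le {s : ℂ} (h0 : 6 ≤ s.re) (h1 : s.re ≤ 13 / 2)
    (ht : 19 / 2 ≤ s.im ^ 2) {n : ℕ} (hn : n ≠ 0) :
    ((n : ℝ) ^ 2 * ((159 / 4 : ℝ) / ((11 / 2 + (n + 1 : ℕ) : ℝ) ^ 2 + 19 / 2))) ^ (s.re - 6) *
      ‖Complex.GammaSeq (12 - s) n‖ ≤ ‖Complex.GammaSeq s n‖ := by
  have hn' : (0 : ℝ) < n := by positivity
  have him : s.im ≠ 0 := by rintro h; norm_num [h] at ht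
  have hp (w : ℂ) (hw : w.im ≠ 0) : 0 < ∏ j ∈ Finset.range (n + 1), ‖w + j‖ :=
    Finset.prod_pos fun j _ ↦ norm_pos_iff.2 fun h ↦ hw (by simpa using congrArg Complex.im h)
  have hA := hp s him
  have hB := hp (12 - s) (by simpa using him)
  rw [norm_GammaSeq _ hn, norm_GammaSeq _ hn, Real.mul_rpow (by positivity) (by positivity),
    ← mul_div_assoc, div_le_div_iff₀ hB hA]
  have e : (n : ℝ) ^ s.re = ((n : ℝ) ^ 2) ^ (s.re - 6) * (n : ℝ) ^ (12 - s).re := by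
    rw [← Real.rpow_natCast_mul hn'.le, ← Real.rpow_add hn']
    congr 1
    simp
    ring
  rw [e]
  have := mul_le_mul_of_nonneg_left (rpow_mul_prod_norm_add_natCast_le h0 h1 ht (n + 1))
    (show 0 ≤ ((n : ℝ) ^ 2) ^ (s.re - 6) * (n : ℝ) ^ (12 - s).re * n.factorial by positivity)
  linarith

lemma tendsto_sq_mul_div :
    Tendsto (fun n : ℕ ↦ (n : ℝ) ^ 2 * ((159 / 4 : ℝ) / ((11 / 2 + (n + 1 : ℕ) : ℝ) ^ 2 + 19 / 2)))
      atTop (𝓝 (159 / 4)) := by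
  have h : Tendsto (fun n : ℕ ↦ (159 / 4 : ℝ) /
      ((13 / 2 * (n : ℝ)⁻¹ + 1) ^ 2 + 19 / 2 * (n : ℝ)⁻¹ ^ 2)) atTop
      (𝓝 ((159 / 4 : ℝ) / ((13 / 2 * 0 + 1) ^ 2 + 19 / 2 * 0 ^ 2))) := by
    have hi : Tendsto (fun n : ℕ ↦ (n : ℝ)⁻¹) atTop (𝓝 0) := tendsto_inv_atTop_nhds_zero_nat
    exact tendsto_const_nhds.div ((((hi.const_mul _).add_const 1).pow 2).add
      ((hi.pow 2).const_mul _)) (by norm_num)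
  norm_num at h
  refine h.congr' ?_
  filter_upwards [eventually_ne_atTop 0] with n hn
  have : (n : ℝ) ≠ 0 := by exact_mod_cast hn
  push_cast
  field_simp
  ring

lemma rpow_mul_norm_Gamma_le {s : ℂ} (h0 : 6 ≤ s.re) (h1 : s.re ≤ 13 / 2)
    (ht : 19 / 2 ≤ s.im ^ 2) :
    (159 / 4 : ℝ) ^ (s.re - 6) * ‖Complex.Gamma (12 - s)‖ ≤ ‖Complex.Gamma s‖ := by
  refine le_of_tendsto_of_tendsto
    ((tendsto_sq_mul_div.rpow_const (.inl (by norm_num))).mul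
      (Complex.GammaSeq_tendsto_Gamma (12 - s)).norm)
    (Complex.GammaSeq_tendsto_Gamma s).norm ?_
  filter_upwards [eventually_ne_atTop 0] with n hn using rpow_mul_norm_GammaSeq_le h0 h1 ht hn

/-- The functional equation of the completed `L`-function of `Δ`. -/
lemma completed_discriminant_functional_equation (s : ℂ) :
    ModularForm.Λ (Γ := 𝒮ℒ) (k := 12) (by norm_num) CuspForm.discriminant (12 - s) =
      ModularForm.Λ (Γ := 𝒮ℒ) (k := 12) (by norm_num) CuspForm.discriminant s := by
  have hk : (0 : ℤ) < 12 := by norm_num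
  have hP := CuspForm.isStrongFEPair (Γ := 𝒮ℒ) (k := 12) hk CuspForm.discriminant
  have h := (ModularForm.weakFEPair (Γ := 𝒮ℒ) (k := 12) hk
    CuspForm.discriminant).functional_equation s
  have hI : Complex.I ^ (12 : ℤ) = 1 := by
    rw [show (12 : ℤ) = ((4 * 3 : ℕ) : ℤ) by norm_num, zpow_natCast, pow_mul, Complex.I_pow_four,
      one_pow]
  -- Invariance of `Δ` under `z ↦ -1/z` makes the pair self-dual.
  have hg : (ModularForm.weakFEPair (Γ := 𝒮ℒ) (k := 12) hk CuspForm.discriminant).g =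
      (ModularForm.weakFEPair (Γ := 𝒮ℒ) (k := 12) hk CuspForm.discriminant).f := by
    ext t
    exact congrFun ModularForm.discriminant_S_invariant (UpperHalfPlane.ofComplex (Complex.I * t))
  rw [hP.symm_Λ_eq, hg, ← hP.Λ_eq] at h
  simpa [hI, ModularForm.Λ] using h

lemma norm_Gammaℂ (s : ℂ) :
    ‖Complex.Gammaℂ s‖ = 2 * (2 * Real.pi) ^ (-s.re) * ‖Complex.Gamma s‖ := by
  rw [Complex.Gammaℂ_def, norm_mul, norm_mul, ← Complex.ofReal_ofNat, ← Complex.ofReal_mul,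
    Complex.norm_cpow_eq_rpow_re_of_pos (by positivity)]
  simp

lemma norm_Gammaℂ_twelve_sub_lt {s : ℂ} (h0 : 6 < s.re) (h1 : s.re ≤ 13 / 2)
    (ht : 19 / 2 ≤ s.im ^ 2) : ‖Complex.Gammaℂ (12 - s)‖ < ‖Complex.Gammaℂ s‖ := by
  have hG : 0 < ‖Complex.Gamma (12 - s)‖ := norm_pos_iff.2 <|
    Complex.Gamma_ne_zero_of_re_pos (by simp; linarith)
  -- The decisive numerical margin: `4π² ≈ 39.48 < 39.75`. This is what the choice of `19/2`
  -- secures.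
  have hpi : (2 * Real.pi) ^ 2 < 159 / 4 := by nlinarith [Real.pi_lt_d4, Real.pi_pos]
  rw [norm_Gammaℂ, norm_Gammaℂ, mul_assoc, mul_assoc]
  refine mul_lt_mul_of_pos_left ?_ two_pos
  have e : (2 * Real.pi) ^ (-(12 - s).re) =
      (2 * Real.pi) ^ (-s.re) * ((2 * Real.pi) ^ 2) ^ (s.re - 6) := by
    rw [← Real.rpow_natCast_mul (by positivity), ← Real.rpow_add (by positivity)]
    congr 1
    simp
    ring
  rw [e, mul_assoc]
  refine mul_lt_mul_of_pos_left ?_ (by positivity)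
  exact (mul_lt_mul_of_pos_right (Real.rpow_lt_rpow (by positivity) hpi (by linarith)) hG).trans_le
    (rpow_mul_norm_Gamma_le h0.le h1 ht)

theorem theorem2 (s : ℂ) (hσ : 6 < s.re) (hσ' : s.re < 13 / 2) (ht : 3.8085 ≤ s.im)
    (hs : ramanujanL s ≠ 0) :
    ‖ramanujanL s‖ < ‖ramanujanL (12 - s)‖ := by
  have hlt := norm_Gammaℂ_twelve_sub_lt hσ hσ'.le (by nlinarith)
  have hpos : 0 < ‖Complex.Gammaℂ (12 - s)‖ := by
    rw [norm_Gammaℂ]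
    have := norm_pos_iff.2 (Complex.Gamma_ne_zero_of_re_pos (s := 12 - s) (by simp; linarith))
    positivity
  unfold ramanujanL ModularForm.L at hs ⊢
  rw [completed_discriminant_functional_equation, norm_mul, norm_mul, norm_div, norm_div]
  -- Both sides share the factor `‖Λ(s)‖`, nonzero because `F(s) ≠ 0`.
  refine mul_lt_mul_of_pos_left ?_ (norm_pos_iff.2 (left_ne_zero_of_mul hs))
  exact div_lt_div_of_pos_left (by simp) hpos hlt
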